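/- An ai-semiring is a nonempty set with two associative binary operations $+$ and $\cdot$, where $+$ is commutative and idempotent and $\cdot$ distributes over $+$ on both sides. A variety is a class of ai-semirings closed under subalgebras, homomorphic images and direct products; $\mathsf V(A)$ is the smallest variety containing $A$. An ai-semiring is subdirectly irreducible if it is trivial or has a least congruence among those different from equality. A flat semiring is an ai-semiring with a multiplicative zero $\infty$ such that $x+y=\infty$ whenever $x\ne y$. $S_7$ is the flat semiring $\{\infty,a,1\}$ in which $1$ is a multiplicative identity and $a\cdot a=\infty$; $M_2$ is the flat semiring $\{\infty,1\}$ with $1\cdot 1=1$. Let $\mathscr F$ be a (possibly empty) family of nonempty subsets of a finite set $I$, and let $\mathbb H_{\mathscr F}$ be the hypergraph with vertex set $\mathscr F$ whose hyperedges are the sets of pairwise disjoint members of $\mathscr F$ with union $I$. The family $\mathscr F$ is a partition system if every $A\in\mathscr F$ lies in a hyperedge of $\mathbb H_{\mathscr F}$ and no $A\in\mathscr F$ is the disjoint union of a set of members of $\mathscr F$ that are proper subsets of $A$; then $\mathbb H=\mathbb H_{\mathscr F}$ (and any hypergraph isomorphic to it) is called a block hypergraph. In this case let $\overline{\mathscr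 F}$ be the set of all unions $\bigcup D$, where $D$ is a nonempty subset of a hyperedge. $S_{\mathbb H}$ is the flat semiring on $\overline{\mathscr F}\cup\{\infty\}$ with $A\cdot B=A\cup B$ if $A\cap B=\varnothing$ and $A\cup B\in\overline{\mathscr F}$, and $A\cdot B=\infty$ otherwise. $S^1_{\mathbb H}$ is the flat semiring obtained from $S_{\mathbb H}$ by adjoining a new multiplicative identity $1$ (so $1+x=\infty$ for all $x\neq 1$). **Theorem.** Let $S$ be a finite subdirectly irreducible member of $\mathsf V(S_7)$. Then precisely one of the following statements holds: 1. $S$ is isomorphic to $M_2$; 2. $S$ contains a copy of $S_7$ as a subsemiring; 3. $S$ is isomorphic to $S_{\mathbb H}$ for some block hypergraph $\mathbb H$. In case 2, $\mathsf V(S)=\mathsf V(S_7)$, and $S$ is isomorphic to $S^1_{\mathbb H}$ for some block hypergraph $\mathbb H$. -/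

import Mathlib

universe u v

namespace AiSem

/-! ### Additively idempotent semirings -/

/-- An additively idempotent semiring: a set with two associative binary operations `+` and `*`,
where `+` is commutative and idempotent and `*` distributes over `+` on both sides.
(No neutral elements are part of the signature, and `*` need not be commutative.) -/
class AiSemiring (S : Type u) extends Distrib S, AddCommSemigroup S, Semigroup S where
  /-- Addition is idempotent. -/
  add_self : ∀ a : S, a + a = a

/-- Homomorphisms of ai-semirings: maps that preserve both operations. -/
def IsHom {S : Type u} {T : Type v} [AiSemiring S] [AiSemiring T] (f : S → T) : Prop :=
  (∀ x y, f (x + y) = f x + f y) ∧ ∀ x y, f (x * y) = f x * f y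

/-- `T` contains a copy of `S` as a subsemiring. -/
def ContainsCopy (S : Type u) (T : Type v) [AiSemiring S] [AiSemiring T] : Prop :=
  ∃ f : S → T, IsHom f ∧ Function.Injective f

/-- The direct product of ai-semirings, with the operations taken coordinatewise. -/
instance {ι : Type v} (A : ι → Type u) [∀ i, AiSemiring (A i)] : AiSemiring (∀ i, A i) where
  add_assoc _ _ _ := funext fun _ => add_assoc _ _ _
  add_comm _ _ := funext fun _ => add_comm _ _
  mul_assoc _ _ _ := funext fun _ => mul_assoc _ _ _
  left_distrib _ _ _ := funext fun _ => mul_add _ _ _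
  right_distrib _ _ _ := funext fun _ => add_mul _ _ _
  add_self _ := funext fun _ => AiSemiring.add_self _

/-- A variety of ai-semirings: a class closed under subalgebras (up to isomorphism),
homomorphic images and arbitrary direct products. -/
structure IsVariety (K : ∀ (A : Type u) [AiSemiring A], Prop) : Prop where
  sub : ∀ (A B : Type u) [AiSemiring A] [AiSemiring B] [Nonempty B] (f : B → A),
    IsHom f → Function.Injective f → K A → K B
  image : ∀ (A B : Type u) [AiSemiring A] [AiSemiring B] (f : A → B),
    IsHom f → Function.Surjective f → K A → K B
  prod : ∀ (ι : Type u) (A : ι → Type u) [∀ i, AiSemiring (A i)],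
    (∀ i, K (A i)) → K (∀ i, A i)

/-- `InVariety G A`: `A` is a member of the variety `V(G)` generated by `G`, the smallest variety
that contains `G`. -/
def InVariety (G A : Type u) [AiSemiring G] [AiSemiring A] : Prop :=
  ∀ K : ∀ (B : Type u) [AiSemiring B], Prop, IsVariety K → K G → K A

/-- `A` is subdirectly irreducible: it is trivial, or it has a least congruence among those
different from equality. -/
def SubdirectlyIrreducible (A : Type u) [AiSemiring A] : Prop :=
  Subsingleton A ∨ ∃ μ : RingCon A, IsLeast {c : RingCon A | c ≠ ⊥} μ

/-! ### The semirings `S₇` and `M₂` -/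

/-- The underlying set `{∞, a, 1}` of `S₇`. -/
inductive S7 : Type u
  | inf
  | a
  | one

namespace S7

instance : Add S7.{u} where
  add
    | a, a => a
    | one, one => one
    | _, _ => inf

instance : Mul S7.{u} where
  mul
    | one, x => x
    | x, one => x
    | _, _ => inf

instance : AiSemiring S7.{u} where
  add_assoc x y z := by cases x <;> cases y <;> cases z <;> rfl
  add_comm x y := by cases x <;> cases y <;> rfl
  mul_assoc x y z := by cases x <;> cases y <;> cases z <;> rfl
  left_distrib x y z := by cases x <;> cases y <;> cases z <;> rfl
  right_distrib x y z := by cases x <;> cases y <;> cases z <;> rfl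
  add_self x := by cases x <;> rfl

end S7

/-- The underlying set `{∞, 1}` of `M₂`. -/
inductive M2 : Type
  | inf
  | one

namespace M2

instance : Add M2 where
  add
    | one, one => one
    | _, _ => inf

instance : Mul M2 where
  mul
    | one, one => one
    | _, _ => inf

instance : AiSemiring M2 where
  add_assoc x y z := by cases x <;> cases y <;> cases z <;> rfl
  add_comm x y := by cases x <;> cases y <;> rfl
  mul_assoc x y z := by cases x <;> cases y <;> cases z <;> rfl
  left_distrib x y z := by cases x <;> cases y <;> cases z <;> rfl
  right_distrib x y z := by cases x <;> cases y <;> cases z <;> rfl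
  add_self x := by cases x <;> rfl

end M2

/-! ### Flat extensions of partial semigroups -/

/-- A cancellative partial semigroup: a partial multiplication (`none` means undefined) such that
`(xy)z` is defined if and only if `x(yz)` is, in which case they agree, and such that
`ab = ac` (both defined) implies `b = c`, and dually. -/
class PartialSemigroup (P : Type u) where
  /-- The partial multiplication. -/
  pmul : P → P → Option P
  assoc : ∀ x y z, (pmul x y).bind (fun w => pmul w z) = (pmul y z).bind (fun w => pmul x w)
  left_cancel : ∀ {a b c d}, pmul a b = some d → pmul a c = some d → b = c
  right_cancel : ∀ {a b c d}, pmul b a = some d → pmul c a = some d → b = c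

open PartialSemigroup

/-- The underlying set `P ∪ {∞}` of the flat extension of `P`. -/
inductive Flat (P : Type u) : Type u
  | inf
  | elem (x : P)

namespace Flat

variable {P : Type u}

open Classical in
/-- Distinct elements of a flat semiring have sum `∞`. -/
noncomputable instance : Add (Flat P) where
  add x y := if x = y then x else inf

/-- Undefined products become `∞`, and `∞` is a multiplicative zero. -/
instance [PartialSemigroup P] : Mul (Flat P) where
  mul
    | elem x, elem y =>
      match pmul x y with
      | some z => elem z
      | none => inf
    | _, _ => inf

theorem add_def (x y : Flat P) [Decidable (x = y)] : x + y = if x = y then x else inf := by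
  change (@ite _ (x = y) (Classical.propDecidable _) x inf) = _
  congr

variable [PartialSemigroup P]

theorem inf_mul (x : Flat P) : inf * x = inf := by cases x <;> rfl

theorem mul_inf (x : Flat P) : x * inf = inf := by cases x <;> rfl

theorem elem_mul (x y : P) :
    (elem x * elem y : Flat P) = (pmul x y).elim inf elem := by
  change (match pmul x y with | some z => elem z | none => inf) = _
  cases pmul x y <;> rfl

theorem elem_mul_option (x : P) (o : Option P) :
    (elem x * o.elim inf elem : Flat P) = (o.bind (fun w => pmul x w)).elim inf elem := by
  cases o
  · exact mul_inf _
  · exact elem_mul _ _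

theorem option_mul_elem (x : P) (o : Option P) :
    (o.elim inf elem * elem x : Flat P) = (o.bind (fun w => pmul w x)).elim inf elem := by
  cases o
  · exact inf_mul _
  · exact elem_mul _ _

theorem mul_ne {x y z : Flat P} (h : y ≠ z) : x * y ≠ x * z ∨ x * y = inf := by
  by_contra hc
  push Not at hc
  obtain ⟨h1, h2⟩ := hc
  rcases x with _ | x
  · exact h2 (inf_mul _)
  rcases y with _ | y
  · exact h2 (mul_inf _)
  rcases z with _ | z
  · exact h2 (h1.trans (mul_inf _))
  rw [elem_mul] at h1 h2
  rw [elem_mul] at h1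
  rcases hy : pmul x y with _ | d
  · rw [hy] at h2; exact h2 rfl
  rcases hz : pmul x z with _ | e
  · rw [hy, hz] at h1; cases h1
  rw [hy, hz] at h1
  cases h1
  exact h (congrArg elem (left_cancel hy hz))

theorem ne_mul {x y z : Flat P} (h : y ≠ z) : y * x ≠ z * x ∨ y * x = inf := by
  by_contra hc
  push Not at hc
  obtain ⟨h1, h2⟩ := hc
  rcases x with _ | x
  · exact h2 (mul_inf _)
  rcases y with _ | y
  · exact h2 (inf_mul _)
  rcases z with _ | z
  · exact h2 (h1.trans (inf_mul _))
  rw [elem_mul] at h1 h2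
  rw [elem_mul] at h1
  rcases hy : pmul y x with _ | d
  · rw [hy] at h2; exact h2 rfl
  rcases hz : pmul z x with _ | e
  · rw [hy, hz] at h1; cases h1
  rw [hy, hz] at h1
  cases h1
  exact h (congrArg elem (right_cancel hy hz))

/-- The flat extension of a cancellative partial semigroup is an ai-semiring. -/
noncomputable instance : AiSemiring (Flat P) where
  add_assoc x y z := by
    classical
    simp only [add_def]
    split_ifs <;> simp_all
  add_comm x y := by
    classical
    simp only [add_def]
    split_ifs <;> simp_all
  mul_assoc x y z := by
    rcases x with _ | x
    · simp only [inf_mul]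
    rcases y with _ | y
    · simp only [inf_mul, mul_inf]
    rcases z with _ | z
    · simp only [mul_inf]
    rw [elem_mul, elem_mul, option_mul_elem, elem_mul_option, assoc]
  left_distrib x y z := by
    classical
    by_cases h : y = z
    · simp [add_def, h]
    · simp only [add_def, h, if_false, mul_inf]
      rcases mul_ne (x := x) h with h' | h'
      · rw [if_neg h']
      · split_ifs <;> simp [h']
  right_distrib x y z := by
    classical
    by_cases h : x = y
    · simp [add_def, h]
    · simp only [add_def, h, if_false, inf_mul]
      rcases ne_mul (x := z) h with h' | h'
      · rw [if_neg h']
      · split_ifs <;> simp [h']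
  add_self x := by
    classical
    simp [add_def]

end Flat

/-! ### Partition systems, block hypergraphs and their semirings -/

/-- For a family `F` of subsets of `I`, the hypergraph `ℍ_F`: its vertices are the members of `F`,
and its hyperedges are the sets of pairwise disjoint members of `F` with union `I`. -/
def partitionHypergraph {I : Type u} (F : Set (Set I)) : Hypergraph (Set I) where
  vertexSet := F
  edgeSet := {E | E ⊆ F ∧ E.PairwiseDisjoint id ∧ ⋃₀ E = Set.univ}
  subset_vertexSet_of_mem_edgeSet' _ h := h.1

/-- A partition system on `I`. The hypergraphs `ℍ_F`, for `F` a partition system on a finite set,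
are the block hypergraphs. -/
structure PartitionSystem (I : Type u) where
  /-- The members of the system. -/
  family : Set (Set I)
  nonempty : ∀ A ∈ family, A.Nonempty
  /-- Every member lies within a hyperedge. -/
  mem_edge : ∀ A ∈ family, ∃ E ∈ (partitionHypergraph family).edgeSet, A ∈ E
  /-- No member is the disjoint union of a set of smaller members. -/
  indecomposable : ∀ A ∈ family, ¬ ∃ G ⊆ family,
    (∀ B ∈ G, B ⊂ A) ∧ G.PairwiseDisjoint id ∧ ⋃₀ G = A

namespace PartitionSystem

variable {I : Type u} (F : PartitionSystem I)

/-- The block hypergraph `ℍ_F`. -/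
def blockHypergraph : Hypergraph (Set I) := partitionHypergraph F.family

/-- The closure of `F` under unions of nonempty subsets of hyperedges of `ℍ_F`. -/
def unions : Set (Set I) :=
  {U | ∃ E ∈ F.blockHypergraph.edgeSet, ∃ D ⊆ E, D.Nonempty ∧ U = ⋃₀ D}

/-- The elements of `S_ℍ` other than `∞`. -/
def Block : Type u := {U : Set I // U ∈ F.unions}

variable {F}

theorem unions_nonempty {U : Set I} (h : U ∈ F.unions) : U.Nonempty := by
  obtain ⟨E, hE, D, hD, ⟨A, hA⟩, rfl⟩ := h
  exact (F.nonempty A (hE.1 (hD hA))).mono (Set.subset_sUnion_of_mem hA)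

theorem unions_split {U V W : Set I} (hU : U ∈ F.unions) (hV : V ∈ F.unions) (hW : W ∈ F.unions)
    (hUV : Disjoint U V) (hW' : Disjoint (U ∪ V) W) (h : U ∪ V ∪ W ∈ F.unions) :
    U ∪ V ∈ F.unions := by
  obtain ⟨E₁, hE₁, D₁, hD₁, hn₁, rfl⟩ := hU
  obtain ⟨E₂, hE₂, D₂, hD₂, hn₂, rfl⟩ := hV
  obtain ⟨E₃, hE₃, D₃, hD₃, hn₃, rfl⟩ := hW
  obtain ⟨E, hE, D, hD, hn, hU⟩ := h
  have key : ∀ A ∈ E \ D, Disjoint A (⋃₀ D₁ ∪ ⋃₀ D₂ ∪ ⋃₀ D₃) := by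
    rintro A ⟨hA, hAD⟩
    rw [hU, Set.disjoint_sUnion_right]
    intro B hB
    exact hE.2.1 hA (hD hB) (fun e => hAD (e ▸ hB))
  refine ⟨D₁ ∪ D₂ ∪ D₃ ∪ (E \ D), ⟨?_, ?_, ?_⟩, D₁ ∪ D₂, ?_, hn₁.inl, ?_⟩
  · intro A hA
    rcases hA with ((hA | hA) | hA) | hA
    · exact hE₁.1 (hD₁ hA)
    · exact hE₂.1 (hD₂ hA)
    · exact hE₃.1 (hD₃ hA)
    · exact hE.1 hA.1
  · have p₁ := hE₁.2.1.subset hD₁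
    have p₂ := hE₂.2.1.subset hD₂
    have p₃ := hE₃.2.1.subset hD₃
    have p₄ := hE.2.1.subset (Set.sdiff_subset (s := E) (t := D))
    have m : ∀ {D : Set (Set I)} {A : Set I}, A ∈ D → A ≤ ⋃₀ D :=
      fun h => Set.subset_sUnion_of_mem h
    rw [Set.disjoint_union_left] at hW'
    refine ((p₁.union p₂ ?_).union p₃ ?_).union p₄ ?_
    · exact fun A hA B hB _ => hUV.mono (m hA) (m hB)
    · rintro A (hA | hA) B hB _
      · exact hW'.1.mono (m hA) (m hB)
      · exact hW'.2.mono (m hA) (m hB)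
    · rintro A hA B hB _
      refine ((key B hB).mono_right ?_).symm
      rcases hA with (hA | hA) | hA
      · exact (m hA).trans (Set.subset_union_left.trans Set.subset_union_left)
      · exact (m hA).trans (Set.subset_union_right.trans Set.subset_union_left)
      · exact (m hA).trans Set.subset_union_right
  · rw [Set.sUnion_union, Set.sUnion_union, Set.sUnion_union, hU, ← Set.sUnion_union,
      Set.union_sdiff_cancel hD, hE.2.2]
  · exact Set.subset_union_left.trans Set.subset_union_left
  · rw [Set.sUnion_union]

open Classical in
/-- The partial product of blocks: the disjoint union, where it is again a block. -/
noncomputable def blockMul (A B : F.Block) : Option F.Block :=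
  if h : Disjoint A.1 B.1 ∧ A.1 ∪ B.1 ∈ F.unions then some ⟨A.1 ∪ B.1, h.2⟩ else none

theorem blockMul_eq_some {A B C : F.Block} :
    blockMul A B = some C ↔ Disjoint A.1 B.1 ∧ A.1 ∪ B.1 = C.1 := by
  unfold blockMul
  constructor
  · intro h
    split_ifs at h with h'
    cases h
    exact ⟨h'.1, rfl⟩
  · rintro ⟨h1, h2⟩
    rw [dif_pos ⟨h1, h2 ▸ C.2⟩]
    exact congrArg some (Subtype.ext h2)

theorem blockMul_comm (A B : F.Block) : blockMul A B = blockMul B A := by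
  ext C
  rw [blockMul_eq_some, blockMul_eq_some, disjoint_comm, Set.union_comm]

theorem blockMul_cancel {A B C D : F.Block} (h1 : blockMul A B = some D)
    (h2 : blockMul A C = some D) : B = C := by
  rw [blockMul_eq_some] at h1 h2
  apply Subtype.ext
  rw [← h1.1.sup_sdiff_cancel_left, ← h2.1.sup_sdiff_cancel_left]
  exact congrArg (· \ A.1) (h1.2.trans h2.2.symm)

theorem bind_eq_some {A B C D : F.Block} :
    (blockMul A B).bind (fun w => blockMul w C) = some D ↔
      Disjoint A.1 B.1 ∧ Disjoint (A.1 ∪ B.1) C.1 ∧ A.1 ∪ B.1 ∪ C.1 = D.1 := by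
  rw [Option.bind_eq_some_iff]
  constructor
  · rintro ⟨W, h1, h2⟩
    rw [blockMul_eq_some] at h1 h2
    rw [h1.2]
    exact ⟨h1.1, h2⟩
  · rintro ⟨h1, h2, h3⟩
    refine ⟨⟨A.1 ∪ B.1, unions_split A.2 B.2 C.2 h1 h2 (h3 ▸ D.2)⟩, ?_, ?_⟩
    · exact blockMul_eq_some.2 ⟨h1, rfl⟩
    · exact blockMul_eq_some.2 ⟨h2, h3⟩

theorem blockMul_assoc (A B C : F.Block) :
    (blockMul A B).bind (fun w => blockMul w C) = (blockMul B C).bind (fun w => blockMul A w) := by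
  have : (fun w => blockMul A w) = fun w => blockMul w A := funext fun w => blockMul_comm A w
  rw [this]
  ext D
  rw [bind_eq_some, bind_eq_some, Set.disjoint_union_left, Set.disjoint_union_left,
    Set.union_comm (B.1 ∪ C.1), ← Set.union_assoc, disjoint_comm (a := B.1) (b := A.1),
    disjoint_comm (a := C.1) (b := A.1)]
  tauto

theorem blockMul_ne (A B : F.Block) : blockMul A B ≠ some A := by
  intro h
  rw [blockMul_eq_some] at h
  obtain ⟨x, hx⟩ := unions_nonempty B.2
  exact Set.disjoint_left.1 h.1 (h.2 ▸ Or.inr hx) hx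

noncomputable instance : PartialSemigroup F.Block where
  pmul := blockMul
  assoc := blockMul_assoc
  left_cancel := blockMul_cancel
  right_cancel {a b c d} h1 h2 := by
    rw [blockMul_comm] at h1 h2
    exact blockMul_cancel h1 h2

/-- The blocks with a new element `1` (here `none`) adjoined that acts as an identity. -/
noncomputable instance : PartialSemigroup (Option F.Block) where
  pmul
    | none, y => some y
    | x, none => some x
    | some A, some B => (blockMul A B).map some
  assoc x y z := by
    rcases x with _ | A
    · cases y <;> cases z <;> simp
    rcases y with _ | B
    · cases z <;> simp
    rcases z with _ | C
    · simp only [Option.bind_some]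
      cases blockMul A B <;> rfl
    have := congrArg (Option.map some) (blockMul_assoc A B C)
    simpa [Option.map_bind, Option.bind_map, Function.comp_def] using this
  left_cancel {a b c d} h1 h2 := by
    rcases a with _ | A
    · simp_all
    rcases b with _ | B <;> rcases c with _ | C
    · rfl
    · cases h1
      simp only [Option.map_eq_some_iff] at h2
      obtain ⟨X, hX, e⟩ := h2
      cases e
      exact absurd hX (blockMul_ne _ _)
    · cases h2
      simp only [Option.map_eq_some_iff] at h1
      obtain ⟨X, hX, e⟩ := h1
      cases e
      exact absurd hX (blockMul_ne _ _)
    · simp only [Option.map_eq_some_iff] at h1 h2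
      obtain ⟨X, hX, e⟩ := h1
      obtain ⟨Y, hY, e'⟩ := h2
      cases e
      cases e'
      exact congrArg some (blockMul_cancel hX hY)
  right_cancel {a b c d} h1 h2 := by
    rcases a with _ | A
    · rcases b with _ | B <;> rcases c with _ | C <;> simp_all
    rcases b with _ | B <;> rcases c with _ | C
    · rfl
    · cases h1
      simp only [Option.map_eq_some_iff] at h2
      obtain ⟨X, hX, e⟩ := h2
      cases e
      rw [blockMul_comm] at hX
      exact absurd hX (blockMul_ne _ _)
    · cases h2
      simp only [Option.map_eq_some_iff] at h1
      obtain ⟨X, hX, e⟩ := h1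
      cases e
      rw [blockMul_comm] at hX
      exact absurd hX (blockMul_ne _ _)
    · simp only [Option.map_eq_some_iff] at h1 h2
      obtain ⟨X, hX, e⟩ := h1
      obtain ⟨Y, hY, e'⟩ := h2
      cases e
      cases e'
      rw [blockMul_comm] at hX hY
      exact congrArg some (blockMul_cancel hX hY)

variable (F)

/-- The block hypergraph semiring `S_ℍ` for `ℍ = ℍ_F`: the flat semiring on the unions of nonempty
parts of hyperedges together with `∞`, where the product is the disjoint union if this is again
such a union, and `∞` otherwise. -/
abbrev BlockSemiring : Type u := Flat F.Block

/-- The flat semiring `S¹_ℍ`: `S_ℍ` with a multiplicative identity `1` adjoined. -/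
abbrev BlockSemiringOne : Type u := Flat (Option F.Block)

end PartitionSystem

/-- `S` is isomorphic to `S_ℍ` for some block hypergraph `ℍ`. -/
def IsBlockHypergraphSemiring (S : Type u) [AiSemiring S] : Prop :=
  ∃ (I : Type) (_ : Finite I) (F : PartitionSystem I), Nonempty (S ≃+* F.BlockSemiring)

/-- `S` is isomorphic to `S¹_ℍ` for some block hypergraph `ℍ`. -/
def IsBlockHypergraphSemiringOne (S : Type u) [AiSemiring S] : Prop :=
  ∃ (I : Type) (_ : Finite I) (F : PartitionSystem I), Nonempty (S ≃+* F.BlockSemiringOne)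

end AiSem

/-! Write `x ≤ y` for `x + y = y`. All that is used of membership in `V(S₇)` is that every
inequality "word ≤ finite sum of words" valid in `S₇` holds in `S`
(`InVariety.satisfiesWordInequalities`).

Flatness. In `S₇`, `r x = r y ≠ ∞` forces `x = y`, so `p y ≤ r x + r y + p x` is valid
(`optMul_le`). The syntactic congruences of the principal ideals `{x | x ≤ c}` intersect in
equality, so for a nontrivial subdirectly irreducible `S` one of them is equality. For this `c` the
inequality makes `S` flat with a top `t`, and every element except `t` is `c` or divides it
(`exists_flatOver`). The inequalities `x ≤ x²` and `y ≤ x²y` then show that each element other than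
`t` is either an idempotent, hence the identity, or nil, with square `t`. If `c` is idempotent, then
`S ≅ M₂`. Otherwise an identity `i`, if present, gives a copy `{t, c, i}` of `S₇`, and it remains to
represent the nil elements by sets.

Representation. The points are modelled on the sets of elements that get the value `a` under a
valuation in `S₇` giving value `a` to all words of length at most three with product `c`. The
support of a nil element is the set of points containing it, and products other than `t` become
disjoint unions. The core is the converse, `NilOver.listProd_eq_of_partition`: if the supports of
the letters of a word partition the set of points, then "word ≤ sum of the short words for `c`" is
valid in `S₇`. So the product is at most `c`, and by flatness equals `c`. Multiplying by cofactors
extends this to partitions of any support. Hence supports determine nil elements, and the supports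
of the irreducible nil elements form a partition system whose blocks are exactly the supports of the
nil elements. This yields `S_ℍ`, or `S¹_ℍ` if there is an identity.

The alternatives exclude each other because `S_ℍ` has only one idempotent, `M₂` and `S₇` have two,
and `S₇` has more elements than `M₂`. -/

namespace AiSem

open FreeSemigroup (of lift)

/-! ### The inequalities between sums of words that hold in `S₇` -/

/-- Every inequality `w ≤ ∑ W`, with a word `w` and a finite nonempty set `W` of words, that holds
in `S₇` (because `w` takes the value `b ≠ ∞` as soon as all words in `W` do) holds in `A`. -/
def SatisfiesWordInequalities (A : Type u) [AiSemiring A] : Prop :=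
  ∀ (V : Type u) (W : Set (FreeSemigroup V)) (w : FreeSemigroup V), W.Finite → W.Nonempty →
    (∀ (θ : V → S7.{u}) (b : S7.{u}), b ≠ S7.inf → (∀ t ∈ W, lift θ t = b) → lift θ w = b) →
    ∀ (θ : V → A) (c : A), (∀ t ∈ W, lift θ t + c = c) → lift θ w + c = c

theorem IsHom.map_lift {A B V : Type*} [AiSemiring A] [AiSemiring B] {f : A → B} (hf : IsHom f)
    (θ : V → A) (t : FreeSemigroup V) : f (lift θ t) = lift (fun v => f (θ v)) t := by
  induction t using FreeSemigroup.recOnMul with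
  | ih1 x => simp
  | ih2 x y hx hy => simp only [map_mul, hf.2, hx, hy]

/-- Here `s` is the sum of `W`. The second clause lets an upper bound in a homomorphic image be
compared with a sum formed upstairs; this is where finiteness of `W` matters. -/
theorem exists_join {A : Type u} [AiSemiring A] {W : Set A} (hW : W.Finite) (hne : W.Nonempty) :
    ∃ s, (∀ x ∈ W, x + s = s) ∧ ∀ {B : Type u} [AiSemiring B] {f : A → B}, IsHom f →
      ∀ c, (∀ x ∈ W, f x + c = c) → f s + c = c := by
  induction W, hW using Set.Finite.induction_on with
  | empty => exact absurd hne Set.not_nonempty_empty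
  | @insert a W _ _ ih =>
    rcases W.eq_empty_or_nonempty with rfl | hne'
    · refine ⟨a, ?_, ?_⟩
      · rintro x (rfl | hx)
        · exact AiSemiring.add_self _
        · exact absurd hx (Set.notMem_empty _)
      · exact fun _ c h => h a (Or.inl rfl)
    obtain ⟨s, h1, h2⟩ := ih hne'
    refine ⟨a + s, ?_, ?_⟩
    · rintro x (rfl | hx)
      · rw [← add_assoc, AiSemiring.add_self]
      · rw [add_left_comm, h1 x hx]
    · intro B _ f hf c h
      rw [hf.1, add_assoc, h2 hf c fun x hx => h x (Or.inr hx), h a (Or.inl rfl)]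

theorem isVariety_satisfiesWordInequalities :
    IsVariety (fun (A : Type u) _ => SatisfiesWordInequalities A) where
  sub A B _ _ _ f hf hinj hA V W w hW hne h θ c hc := by
    apply hinj
    rw [hf.1, hf.map_lift]
    refine hA V W w hW hne h _ _ fun t ht => ?_
    rw [← hf.map_lift, ← hf.1, hc t ht]
  image A B _ _ f hf hsurj hA V W w hW hne h θ c hc := by
    choose g hg using hsurj
    -- The bound `c` has no preimage that bounds the lifted words, so the inequality is applied in
    -- `A` to the sum `s` of their values, and `f s ≤ c`.
    obtain ⟨s, h1, h2⟩ := exists_join (hW.image (lift fun v => g (θ v))) (hne.image _)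
    have h3 := hA V W w hW hne h (fun v => g (θ v)) s fun t ht => h1 _ ⟨t, ht, rfl⟩
    have h4 : f s + c = c := by
      refine h2 hf c ?_
      rintro _ ⟨t, ht, rfl⟩
      rw [hf.map_lift]
      simpa only [hg] using hc t ht
    have h5 := congrArg f h3
    rw [hf.1, hf.map_lift] at h5
    simp only [hg] at h5
    rw [← h4, ← add_assoc, h5]
  prod ι A _ hA V W w hW hne h θ c hc := by
    funext i
    have hf : IsHom (fun x : ∀ i, A i => x i) := ⟨fun _ _ => rfl, fun _ _ => rfl⟩
    have key : ∀ t, (lift θ t) i = lift (fun v => θ v i) t := fun t => hf.map_lift θ t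
    change (lift θ w) i + c i = c i
    rw [key]
    refine hA i V W w hW hne h _ _ fun t ht => ?_
    rw [← key]
    exact congrFun (hc t ht) i

theorem S7.eq_of_add_eq {x b : S7.{u}} (hb : b ≠ S7.inf) (h : x + b = b) : x = b := by
  cases x <;> cases b <;> first | rfl | exact absurd rfl hb | cases h

/-- The value `∞` is the top and bounds everything; below any other value there is only that value
itself. -/
theorem S7.satisfiesWordInequalities : SatisfiesWordInequalities S7.{u} := by
  intro V W w _ _ h θ c hc
  by_cases hb : c = S7.inf
  · subst hb
    cases lift θ w <;> rfl
  · rw [h θ c hb fun t ht => S7.eq_of_add_eq hb (hc t ht), AiSemiring.add_self]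

theorem InVariety.satisfiesWordInequalities {S : Type u} [AiSemiring S]
    (h : InVariety S7.{u} S) : SatisfiesWordInequalities S :=
  h (fun A _ => SatisfiesWordInequalities A) isVariety_satisfiesWordInequalities
    S7.satisfiesWordInequalities

/-! ### Particular inequalities of `S₇` -/

namespace SatisfiesWordInequalities

variable {S : Type u} [AiSemiring S] (hS : SatisfiesWordInequalities S)
include hS

theorem le_of_list (W : List (FreeSemigroup S)) (w : FreeSemigroup S) (hW : W ≠ [])
    (h : ∀ (θ : S → S7.{u}) (b : S7.{u}), b ≠ S7.inf → (∀ t ∈ W, lift θ t = b) → lift θ w = b)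
    (c : S) (hc : ∀ t ∈ W, lift id t + c = c) : lift id w + c = c :=
  hS S {t | t ∈ W} w W.finite_toSet (List.exists_mem_of_ne_nil W hW) h id c hc

theorem mul_comm (x y : S) : x * y = y * x := by
  have key : ∀ x y : S, x * y + y * x = y * x := by
    intro x y
    have := hS.le_of_list [of y * of x] (of x * of y) (by simp) (fun θ b _ h => by
      simp only [List.mem_singleton, forall_eq, map_mul, FreeSemigroup.lift_of] at h ⊢
      rw [← h]
      cases θ x <;> cases θ y <;> rfl) (y * x) (by simp [AiSemiring.add_self])
    simpa using this
  rw [← key y x, add_comm, key]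

/-- In `S₇`, only `1` has a square other than `∞`. The same observation gives `add_sq_mul`. -/
theorem add_sq (x : S) : x + x * x = x * x := by
  have := hS.le_of_list [of x * of x] (of x) (by simp) (fun θ b hb h => by
    simp only [List.mem_singleton, forall_eq, map_mul, FreeSemigroup.lift_of] at h ⊢
    revert hb
    rw [← h]
    cases θ x <;> intro hb <;> first | rfl | exact absurd rfl hb) (x * x)
      (by simp [AiSemiring.add_self])
  simpa using this

theorem add_sq_mul (x y : S) : y + x * x * y = x * x * y := by
  have := hS.le_of_list [of x * of x * of y] (of y) (by simp) (fun θ b hb h => by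
    simp only [List.mem_singleton, forall_eq, map_mul, FreeSemigroup.lift_of] at h ⊢
    revert hb
    rw [← h]
    cases θ x <;> cases θ y <;> intro hb <;> first | rfl | exact absurd rfl hb) (x * x * y)
      (by simp [AiSemiring.add_self])
  simpa using this

end SatisfiesWordInequalities

/-- The product `z * x`, where `z` may be missing. -/
def optMul {S : Type*} [Mul S] (z : Option S) (x : S) : S := z.elim x (· * x)

/-- Multiplication in `S₇` is cancellative away from `∞`, so the first two hypotheses already give
`x = y`. -/
theorem S7.eq_of_optMul {r p : Option S7.{u}} {x y b : S7.{u}} (hb : b ≠ S7.inf)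
    (h1 : optMul r x = b) (h2 : optMul r y = b) (h3 : optMul p x = b) : optMul p y = b := by
  have : x = y := by
    cases h1
    rcases r with _ | r
    · exact h2.symm
    · cases r <;> cases x <;> cases y <;> first | rfl | exact absurd rfl hb | cases h2
  rwa [← this]

theorem lift_optMul {S T : Type*} [Semigroup T] (θ : S → T) (z : Option S) (x : S) :
    lift θ (optMul (z.map of) (of x)) = optMul (z.map θ) (θ x) := by
  cases z <;> simp [optMul]

theorem SatisfiesWordInequalities.optMul_le {S : Type u} [AiSemiring S]
    (hS : SatisfiesWordInequalities S) {r p : Option S} {x y c : S} (h1 : optMul r x + c = c)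
    (h2 : optMul r y + c = c) (h3 : optMul p x + c = c) : optMul p y + c = c := by
  have := hS.le_of_list [optMul (r.map of) (of x), optMul (r.map of) (of y),
    optMul (p.map of) (of x)] (optMul (p.map of) (of y)) (by simp) (fun θ b hb h => by
      simp only [lift_optMul, List.mem_cons, List.not_mem_nil, or_false, forall_eq_or_imp,
        forall_eq] at h ⊢
      exact S7.eq_of_optMul hb h.1 h.2.1 h.2.2) c (by
        simpa [lift_optMul] using ⟨h1, h2, h3⟩)
  simpa [lift_optMul] using this

/-! ### Subdirectly irreducible members are flat -/

theorem optMul_add {S : Type*} [AiSemiring S] (z : Option S) (x y : S) :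
    optMul z (x + y) = optMul z x + optMul z y := by
  cases z
  · rfl
  · exact mul_add _ _ _

theorem add_le_iff {S : Type*} [AiSemiring S] {x y c : S} :
    x + y + c = c ↔ x + c = c ∧ y + c = c := by
  constructor
  · intro h
    constructor
    · rw [← h, ← add_assoc, ← add_assoc, AiSemiring.add_self]
    · rw [← h, add_comm x y, ← add_assoc, ← add_assoc, AiSemiring.add_self]
  · rintro ⟨h1, h2⟩
    rw [add_assoc, h2, h1]

/-- The syntactic congruence of the principal ideal below `c`. -/
def syntacticCon {S : Type*} [AiSemiring S] (hcomm : ∀ x y : S, x * y = y * x) (c : S) :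
    RingCon S where
  r x y := ∀ z, optMul z x + c = c ↔ optMul z y + c = c
  iseqv := ⟨fun _ _ => Iff.rfl, fun h z => (h z).symm, fun h h' z => (h z).trans (h' z)⟩
  add' {w x y z} h h' p := by
    rw [optMul_add, optMul_add, add_le_iff, add_le_iff, h p, h' p]
  mul' {w x y z} h h' p := by
    have key : ∀ (p : Option S) (x y : S), optMul p (x * y) = optMul (some (optMul p x)) y := by
      intro p x y
      cases p
      · rfl
      · exact (mul_assoc _ _ _).symm
    rw [key, h', ← key, hcomm w z, key, h, ← key, hcomm z x]

theorem syntacticCon_iff {S : Type*} [AiSemiring S] {hcomm : ∀ x y : S, x * y = y * x} {c : S}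
    {x y : S} :
    syntacticCon hcomm c x y ↔ ∀ z, optMul z x + c = c ↔ optMul z y + c = c := Iff.rfl

/-- A commutative flat semiring with top element `t`, in which every other element divides
`c ≠ t`. -/
structure FlatOver {S : Type*} [AiSemiring S] (t c : S) : Prop where
  mul_comm : ∀ x y : S, x * y = y * x
  mul_top : ∀ x, x * t = t
  add_of_ne : ∀ x y : S, x ≠ y → x + y = t
  ne_top : c ≠ t
  dvd : ∀ x, x ≠ t → x = c ∨ ∃ z, z * x = c

/-- Take `c` whose syntactic congruence is equality. By `optMul_le`, two elements with a common
multiplier into the ideal below `c` have all such multipliers in common, hence coincide; elements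
with no such multiplier also coincide, and form the top. -/
theorem SubdirectlyIrreducible.exists_flatOver {S : Type u} [AiSemiring S] [Finite S]
    (hS : SatisfiesWordInequalities S) (hsi : SubdirectlyIrreducible S) [Nontrivial S] :
    ∃ t c : S, FlatOver t c := by
  have hc : ∃ c, syntacticCon hS.mul_comm c = ⊥ := by
    -- Otherwise the least nontrivial congruence lies in every syntactic congruence. Using those of
    -- `x` and `y` for a related pair gives `y ≤ x` and `x ≤ y`.
    by_contra! hc
    rcases hsi with h | ⟨μ, hμ, hle⟩
    · exact not_subsingleton S h
    · refine hμ (RingCon.ext fun x y => ⟨fun h => ?_, fun h => ?_⟩)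
      · have h1 := syntacticCon_iff.1 (hle (hc x) h) none
        have h2 := syntacticCon_iff.1 (hle (hc y) h) none
        have h3 : y + x = x := h1.1 (AiSemiring.add_self x)
        have h4 : x + y = y := h2.2 (AiSemiring.add_self y)
        rw [← h3, add_comm, h4]
        rfl
      · cases h
        exact μ.refl _
  obtain ⟨c, hc⟩ := hc
  have hext : ∀ x y : S, (∀ z, optMul z x + c = c ↔ optMul z y + c = c) → x = y := by
    intro x y h
    have : syntacticCon hS.mul_comm c x y := h
    rwa [hc] at this
  have heq : ∀ r (x y : S), optMul r x + c = c → optMul r y + c = c → x = y := fun r x y hx hy =>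
    hext x y fun p => ⟨hS.optMul_le hx hy, hS.optMul_le hy hx⟩
  obtain ⟨t, ht, -⟩ := exists_join (A := S) (Set.finite_univ (α := S)) Set.univ_nonempty
  -- A multiplier that takes the top below `c` takes every element below `c`, and then all elements
  -- coincide.
  have hno : ∀ z, ¬ optMul z t + c = c := by
    intro z hz
    obtain ⟨x, y, hxy⟩ := exists_pair_ne S
    have : ∀ x, optMul z x + c = c := by
      intro x
      rw [← ht x trivial, optMul_add, add_le_iff] at hz
      exact hz.1
    exact hxy (heq z x y (this x) (this y))
  have htop : ∀ x, (∀ z, ¬ optMul z x + c = c) → x = t := fun x hx =>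
    hext x t fun z => iff_of_false (hx z) (hno z)
  have hadd : ∀ x y : S, x ≠ y → x + y = t := by
    intro x y hxy
    refine htop _ fun z hz => ?_
    rw [optMul_add, add_le_iff] at hz
    exact hxy (heq z x y hz.1 hz.2)
  have hct : c ≠ t := by
    rintro rfl
    exact hno none (AiSemiring.add_self _)
  refine ⟨t, c, hS.mul_comm, fun x => htop _ fun z hz => ?_, hadd, hct, fun x hx => ?_⟩
  · rcases z with _ | z
    · exact hno (some x) hz
    · exact hno (some (z * x)) (by simpa [optMul, mul_assoc] using hz)
  · by_contra! hcon
    refine hx (htop x fun z hz => ?_)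
    have : optMul z x ≠ c := by
      rcases z with _ | z
      · exact hcon.1
      · exact hcon.2 z
    exact hct (hz.symm.trans (hadd _ _ this))

end AiSem

namespace AiSem

open FreeSemigroup (of lift)

/-! ### Idempotent and nil elements of a flat semiring -/

namespace FlatOver

variable {S : Type u} [AiSemiring S] {t c : S} (h : FlatOver t c)
include h

theorem top_mul (x : S) : t * x = t := by rw [h.mul_comm, h.mul_top]

theorem add_top (x : S) : x + t = t := by
  by_cases hx : x = t
  · rw [hx, AiSemiring.add_self]
  · exact h.add_of_ne x t hx

theorem eq_of_le {x y : S} (hxy : x + y = y) (hy : y ≠ t) : x = y := by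
  by_contra hne
  exact hy (hxy.symm.trans (h.add_of_ne x y hne))

/-- If `x ≠ y`, then `x + y = t`, and distributivity turns `z * t = t` into `z * x = t`. -/
theorem mul_left_cancel {x y z : S} (hz : z * x = z * y) (hne : z * x ≠ t) : x = y := by
  by_contra hxy
  have := congrArg (z * ·) (h.add_of_ne x y hxy)
  simp only [mul_add, h.mul_top, ← hz, AiSemiring.add_self] at this
  exact hne this

theorem left_ne_top {x y : S} (hxy : x * y ≠ t) : x ≠ t := by
  rintro rfl
  exact hxy (h.top_mul y)

theorem right_ne_top {x y : S} (hxy : x * y ≠ t) : y ≠ t := by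
  rintro rfl
  exact hxy (h.mul_top x)

theorem sq_eq (hS : SatisfiesWordInequalities S) (x : S) : x * x = x ∨ x * x = t := by
  by_cases hx : x * x = t
  · exact Or.inr hx
  · exact Or.inl (h.eq_of_le (hS.add_sq x) hx).symm

/-- An idempotent other than the top element is an identity. -/
theorem idem_mul (hS : SatisfiesWordInequalities S) {e : S} (he : e * e = e) (het : e ≠ t) (y : S) :
    e * y = y := by
  have hle : y + e * y = e * y := by simpa only [he] using hS.add_sq_mul e y
  have key : e * c = c := by
    rcases h.dvd e het with rfl | ⟨z, hz⟩
    · exact he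
    · rw [← hz, h.mul_comm z, ← mul_assoc, he]
  -- The inequality `hle` says nothing when `e * y = t`. In that case `y ≠ t` would be `c` or divide
  -- it, and `e * c = c` would give `c = t`.
  by_cases hey : e * y = t
  · by_cases hy : y = t
    · rw [hey, hy]
    · exfalso
      rcases h.dvd y hy with rfl | ⟨z, hz⟩
      · exact hy (key.symm.trans hey)
      · apply h.ne_top
        rw [← key, ← hz, h.mul_comm z, ← mul_assoc, hey, h.top_mul]
  · exact (h.eq_of_le hle hey).symm

theorem idem_unique (hS : SatisfiesWordInequalities S) {e f : S} (he : e * e = e) (het : e ≠ t)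
    (hf : f * f = f) (hft : f ≠ t) : e = f := by
  rw [← h.idem_mul hS hf hft e, h.mul_comm, h.idem_mul hS he het]

/-- If `c` is idempotent, then it is the only element besides the top. -/
theorem eq_of_idem (hS : SatisfiesWordInequalities S) (hc : c * c = c) {x : S} (hx : x ≠ t) :
    x = c := by
  rcases h.dvd x hx with rfl | ⟨z, hz⟩
  · rfl
  · refine h.idem_unique hS ((h.sq_eq hS x).resolve_right fun hxx => h.ne_top ?_) hx hc h.ne_top
    rw [← hc, ← hz, mul_assoc, h.mul_comm z x, ← mul_assoc x, hxx, h.top_mul, h.mul_top]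

end FlatOver

/-- A flat semiring over `c` in the variety of `S₇`, with `c` not idempotent. -/
structure NilOver {S : Type u} [AiSemiring S] (t c : S) : Prop extends FlatOver t c where
  words : SatisfiesWordInequalities S
  sq_top : c * c = t

/-- The elements whose square is the top element, other than the top element itself. -/
def IsNil {S : Type*} [Mul S] (t x : S) : Prop := x ≠ t ∧ x * x = t

namespace NilOver

variable {S : Type u} [AiSemiring S] {t c : S} (h : NilOver t c)
include h

theorem isNil_or_idem {x : S} (hx : x ≠ t) : IsNil t x ∨ x * x = x :=
  (h.sq_eq h.words x).symm.imp_left fun hxx => ⟨hx, hxx⟩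

theorem isNil_mul {x y : S} (hx : IsNil t x) (hxy : x * y ≠ t) : IsNil t (x * y) :=
  ⟨hxy, by rw [mul_assoc, h.mul_comm y, mul_assoc, ← mul_assoc x, hx.2, h.top_mul]⟩

/-- Every nil element other than `c` divides `c` with a nil cofactor. -/
theorem exists_cofactor {x : S} (hx : IsNil t x) : x = c ∨ ∃ z, IsNil t z ∧ z * x = c := by
  rcases h.dvd x hx.1 with rfl | ⟨z, hz⟩
  · exact Or.inl rfl
  · have hzt : z ≠ t := h.left_ne_top (hz ▸ h.ne_top)
    rcases h.isNil_or_idem hzt with hn | hi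
    · exact Or.inr ⟨z, hn, hz⟩
    · exact Or.inl (by rw [← hz, h.idem_mul h.words hi hzt])

end NilOver

/-! ### Values of words -/

theorem lift_cons {V T : Type*} [Semigroup T] (θ : V → T) (x y : V) (l : List V) :
    lift θ ⟨x, y :: l⟩ = θ x * lift θ ⟨y, l⟩ := by
  rw [← FreeSemigroup.lift_of θ x, ← map_mul]
  rfl

/-- The product of a list, in the semigroup with an identity adjoined. -/
def listProd {S : Type*} [Semigroup S] (l : List S) : WithOne S :=
  (l.map (fun x => (x : WithOne S))).prod

section listProd

variable {S : Type*} [Semigroup S]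

@[simp] theorem listProd_nil : listProd ([] : List S) = 1 := rfl

@[simp] theorem listProd_cons (x : S) (l : List S) : listProd (x :: l) = x * listProd l := by
  simp [listProd]

@[simp] theorem listProd_append (l l' : List S) :
    listProd (l ++ l') = listProd l * listProd l' := by
  simp [listProd]

/-- Free semigroups have no empty word; this links their evaluation to `listProd`, where the empty
list is allowed. -/
theorem coe_lift_id (x : S) (l : List S) :
    ((lift id (⟨x, l⟩ : FreeSemigroup S) : S) : WithOne S) = listProd (x :: l) := by
  induction l generalizing x with
  | nil =>
    change ((lift id (of x) : S) : WithOne S) = _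
    simp
  | cons y l ih => rw [lift_cons, WithOne.coe_mul, ih, listProd_cons x, id]

theorem exists_listProd_eq {l : List S} (hl : l ≠ []) : ∃ x : S, listProd l = x := by
  cases l with
  | nil => exact absurd rfl hl
  | cons x l => exact ⟨_, (coe_lift_id x l).symm⟩

end listProd

theorem S7.ne_inf_iff {x : S7.{u}} : x ≠ S7.inf ↔ x = S7.a ∨ x = S7.one := by
  cases x <;> simp

theorem S7.one_mul (x : S7.{u}) : S7.one * x = x := by cases x <;> rfl

theorem S7.mul_one (x : S7.{u}) : x * S7.one = x := by cases x <;> rfl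

theorem S7.eq_of_mul_eq_a {p q z : S7.{u}} (h : p * z = S7.a) (h' : q * z = S7.a) :
    p = q ∧ q ≠ S7.inf := by
  cases p <;> cases q <;> cases z <;>
    first
    | (cases h; done)
    | (cases h'; done)
    | exact ⟨rfl, S7.noConfusion⟩

theorem S7.mul_eq_a_iff {x y : S7.{u}} (h : x * y ≠ S7.inf) :
    (x * y = S7.a ↔ x = S7.a ∨ y = S7.a) ∧ ¬ (x = S7.a ∧ y = S7.a) := by
  cases x <;> cases y <;> first | exact absurd rfl h | skip
  all_goals simp_all [S7.one_mul, S7.mul_one]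

theorem S7.lift_eq_one {V : Type*} {θ : V → S7.{u}} {x : V} {l : List V}
    (h : ∀ v ∈ x :: l, θ v = S7.one) : lift θ ⟨x, l⟩ = S7.one := by
  induction l generalizing x with
  | nil =>
    change lift θ (of x) = _
    simpa using h
  | cons y l ih =>
    rw [lift_cons, h x (by simp), S7.one_mul]
    exact ih fun v hv => h v (List.mem_cons_of_mem _ hv)

theorem S7.lift_eq_a {V : Type*} {θ : V → S7.{u}} {x : V} {l : List V}
    (h : ∀ v ∈ x :: l, θ v ≠ S7.inf)
    (hp : (x :: l).Pairwise fun u v => ¬ (θ u = S7.a ∧ θ v = S7.a))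
    (hex : ∃ v ∈ x :: l, θ v = S7.a) : lift θ ⟨x, l⟩ = S7.a := by
  induction l generalizing x with
  | nil =>
    change lift θ (of x) = _
    simpa using hex
  | cons y l ih =>
    rw [lift_cons]
    rw [List.pairwise_cons] at hp
    rcases S7.ne_inf_iff.1 (h x (by simp)) with hx | hx
    · rw [hx, S7.lift_eq_one fun v hv => ?_]
      · rfl
      · exact (S7.ne_inf_iff.1 (h v (List.mem_cons_of_mem _ hv))).resolve_left
          fun hv' => hp.1 v hv ⟨hx, hv'⟩
    · rw [hx, S7.one_mul]
      refine ih (fun v hv => h v (List.mem_cons_of_mem _ hv)) hp.2 ?_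
      obtain ⟨v, hv, hva⟩ := hex
      rcases List.mem_cons.1 hv with rfl | hv
      · rw [hx] at hva
        cases hva
      · exact ⟨v, hv, hva⟩

/-! ### The set representation of the nil elements -/

section points

variable {S : Type u} [AiSemiring S] {n : ℕ}

/-- The points of the representation: sets of elements that are additive for the partial
multiplication of nil elements and contain `c`. Elements are replaced by their numbers, to stay
in the lowest universe. -/
def Point (e : S ≃ Fin n) (t c : S) : Type :=
  {X : Set (Fin n) // e c ∈ X ∧ ∀ u v, IsNil t u → IsNil t v → u * v ≠ t →
    (e (u * v) ∈ X ↔ e u ∈ X ∨ e v ∈ X) ∧ ¬ (e u ∈ X ∧ e v ∈ X)}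

instance (e : S ≃ Fin n) (t c : S) : Finite (Point e t c) := by
  unfold Point
  infer_instance

/-- The set of points that contain `u`. -/
def support (e : S ≃ Fin n) (t c u : S) : Set (Point e t c) := {X | e u ∈ X.1}

variable {t c : S} (h : NilOver t c) (e : S ≃ Fin n)

theorem support_self : support e t c c = Set.univ := Set.eq_univ_of_forall fun X => X.2.1

theorem support_mul {u v : S} (hu : IsNil t u) (hv : IsNil t v) (huv : u * v ≠ t) :
    support e t c (u * v) = support e t c u ∪ support e t c v :=
  Set.ext fun X => (X.2.2 u v hu hv huv).1

theorem disjoint_support {u v : S} (hu : IsNil t u) (hv : IsNil t v) (huv : u * v ≠ t) :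
    Disjoint (support e t c u) (support e t c v) :=
  Set.disjoint_left.2 fun X hXu hXv => (X.2.2 u v hu hv huv).2 ⟨hXu, hXv⟩

/-- The words of length at most three with value `c`. -/
def shortWords (c : S) : Set (FreeSemigroup S) :=
  {w | w = of c ∨ (∃ u v, u * v = c ∧ w = of u * of v) ∨
    ∃ u v z, u * v * z = c ∧ w = of u * of v * of z}

theorem finite_shortWords [Finite S] (c : S) : (shortWords c).Finite := by
  refine (((Set.finite_singleton (of c)).union
    (Set.finite_range fun p : S × S => of p.1 * of p.2)).union
    (Set.finite_range fun p : S × S × S => of p.1 * of p.2.1 * of p.2.2)).subset ?_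
  rintro w (rfl | ⟨u, v, -, rfl⟩ | ⟨u, v, z, -, rfl⟩)
  · exact Or.inl (Or.inl rfl)
  · exact Or.inl (Or.inr ⟨(u, v), rfl⟩)
  · exact Or.inr ⟨(u, v, z), rfl⟩

theorem lift_id_of_mem_shortWords {w : FreeSemigroup S} (hw : w ∈ shortWords c) :
    lift id w = c := by
  rcases hw with rfl | ⟨u, v, huv, rfl⟩ | ⟨u, v, z, huv, rfl⟩ <;> simp [*]

include h in
/-- A valuation in `S₇` that gives all short words of value `c` the value `a` is a point. -/
theorem NilOver.point_of_valuation {θ : S → S7.{u}} (hc : θ c = S7.a)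
    (h2 : ∀ u v, u * v = c → θ u * θ v = S7.a)
    (h3 : ∀ u v z, u * v * z = c → θ u * θ v * θ z = S7.a) {u v : S} (huv : u * v ≠ t) :
    (θ (u * v) = S7.a ↔ θ u = S7.a ∨ θ v = S7.a) ∧ ¬ (θ u = S7.a ∧ θ v = S7.a) := by
  -- If `u * v * z = c`, then both `(u * v) * z`, as a word with two letters, and `u * v * z`, with
  -- three, have value `a` under `θ`, and `θ z` cancels. This is why words of length three are
  -- included.
  have key : θ (u * v) = θ u * θ v ∧ θ u * θ v ≠ S7.inf := by
    rcases h.dvd _ huv with huv | ⟨z, hz⟩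
    · rw [h2 u v huv, huv, hc]
      exact ⟨rfl, by simp⟩
    · rw [h.mul_comm] at hz
      have e2 := h2 _ _ hz
      have e3 := h3 _ _ _ hz
      exact S7.eq_of_mul_eq_a e2 e3
  obtain ⟨k1, k2⟩ := key
  rw [k1]
  exact S7.mul_eq_a_iff k2

include h in
/-- If the supports of some nil elements partition the set of points, then their product is `c`. -/
theorem NilOver.listProd_eq_of_partition [Finite S] {l : List S} (hne : l ≠ [])
    (hl : ∀ v ∈ l, IsNil t v)
    (hp : l.Pairwise fun u v => Disjoint (support e t c u) (support e t c v))
    (hcov : ∀ X : Point e t c, ∃ v ∈ l, X ∈ support e t c v) : listProd l = c := by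
  obtain _ | ⟨x, l⟩ := l
  · exact absurd rfl hne
  rw [← coe_lift_id, WithOne.coe_inj]
  refine h.eq_of_le ?_ h.ne_top
  refine h.words S (shortWords c) ⟨x, l⟩ (finite_shortWords c) ⟨_, Or.inl rfl⟩ ?_ id c
    fun w hw => by rw [lift_id_of_mem_shortWords hw, AiSemiring.add_self]
  intro θ b hb hW
  have h1 : θ c = b := by simpa using hW _ (Or.inl rfl)
  have h2 : ∀ u v, u * v = c → θ u * θ v = b := fun u v huv => by
    simpa using hW _ (Or.inr (Or.inl ⟨u, v, huv, rfl⟩))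
  have h3 : ∀ u v z, u * v * z = c → θ u * θ v * θ z = b := fun u v z huv => by
    simpa using hW _ (Or.inr (Or.inr ⟨u, v, z, huv, rfl⟩))
  rcases S7.ne_inf_iff.1 hb with rfl | rfl
  -- The letters of value `a` form a point `X`. Disjoint supports allow at most one letter of the
  -- list in `X`, and covering provides one; since no letter has value `∞`, the word has value `a`.
  · let X : Point e t c := ⟨{k | θ (e.symm k) = S7.a}, by simpa using h1, fun u v _ _ huv => by
      simpa using h.point_of_valuation h1 h2 h3 huv⟩
    have hX : ∀ v, X ∈ support e t c v ↔ θ v = S7.a := fun v => by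
      change θ (e.symm (e v)) = S7.a ↔ _
      rw [e.symm_apply_apply]
    refine S7.lift_eq_a (fun v hv => ?_) (hp.imp fun {u v} huv => ?_) ?_
    · rcases h.exists_cofactor (hl v hv) with rfl | ⟨z, -, hz⟩
      · rw [h1]
        exact hb
      · have := h2 z v hz
        intro hv
        rw [hv] at this
        revert this
        cases θ z <;> intro this <;> cases this
    · rw [← hX, ← hX]
      exact fun hh => Set.disjoint_left.1 huv hh.1 hh.2
    · obtain ⟨v, hv, hXv⟩ := hcov X
      exact ⟨v, hv, (hX v).1 hXv⟩
  · refine S7.lift_eq_one fun v hv => ?_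
    rcases h.exists_cofactor (hl v hv) with rfl | ⟨z, -, hz⟩
    · exact h1
    · have := h2 z v hz
      revert this
      cases θ z <;> cases θ v <;> intro this <;> first | rfl | cases this

end points

end AiSem

namespace AiSem

/-! ### Nil elements are determined by their supports -/

namespace NilOver

variable {S : Type u} [AiSemiring S] [Finite S] {t c : S} (h : NilOver t c) {n : ℕ} (e : S ≃ Fin n)
include h

/-- An element `u` with empty support may be repeated without spoiling a partition. So `u * u`, or
`u * u * z` with `z` a cofactor, would equal `c`, although `u * u = t`. -/
theorem support_nonempty {u : S} (hu : IsNil t u) : (support e t c u).Nonempty := by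
  rw [Set.nonempty_iff_ne_empty]
  intro hempty
  have hd : ∀ v, Disjoint (support e t c u) (support e t c v) := fun v => by
    rw [hempty]
    exact Set.empty_disjoint _
  rcases h.exists_cofactor hu with rfl | ⟨z, hz, hzu⟩
  · rw [support_self] at hempty
    have := h.listProd_eq_of_partition e (l := [u, u]) (by simp) (by simp [hu])
      (by simpa using hd u) fun X => absurd (Set.mem_univ X) (by simp [hempty])
    simp only [listProd_cons, listProd_nil, _root_.mul_one, ← WithOne.coe_mul,
      WithOne.coe_inj] at this
    exact hu.1 (this.symm.trans hu.2)
  · have hzuni : support e t c z = Set.univ := by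
      have hcu : support e t c (z * u) = _ := support_mul e hz hu (hzu ▸ h.ne_top)
      rwa [hempty, Set.union_empty, hzu, support_self, eq_comm] at hcu
    have := h.listProd_eq_of_partition e (l := [u, u, z]) (by simp) (by simp [hu, hz])
      (by simp [hempty]) fun X => ⟨z, by simp, hzuni ▸ Set.mem_univ X⟩
    simp only [listProd_cons, listProd_nil, _root_.mul_one, ← WithOne.coe_mul,
      WithOne.coe_inj, ← mul_assoc, hu.2, h.top_mul] at this
    exact h.ne_top this.symm

/-- If the supports of some nil elements partition the support of `u`, then their product is `u`. -/
theorem listProd_eq_of_partition_support {u : S} (hu : IsNil t u) {l : List S}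
    (hl : ∀ v ∈ l, IsNil t v)
    (hp : l.Pairwise fun u v => Disjoint (support e t c u) (support e t c v))
    (hcov : ∀ X : Point e t c, X ∈ support e t c u ↔ ∃ v ∈ l, X ∈ support e t c v) :
    listProd l = u := by
  have hne : l ≠ [] := by
    rintro rfl
    obtain ⟨X, hX⟩ := h.support_nonempty e hu
    obtain ⟨v, hv, -⟩ := (hcov X).1 hX
    cases hv
  rcases h.exists_cofactor hu with rfl | ⟨z, hz, hzu⟩
  · refine h.listProd_eq_of_partition e hne hl hp fun X => (hcov X).1 ?_
    rw [support_self]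
    trivial
  -- Prepending the cofactor `z` turns the partition of the support of `u` into one of all points;
  -- then `z` is cancelled.
  · have hzut : z * u ≠ t := hzu ▸ h.ne_top
    have key := h.listProd_eq_of_partition e (l := z :: l) (by simp)
      (by simpa using ⟨hz, hl⟩) (List.pairwise_cons.2 ⟨fun v hv => Set.disjoint_left.2
        fun X hXz hXv => Set.disjoint_left.1 (disjoint_support e hz hu hzut) hXz
          ((hcov X).2 ⟨v, hv, hXv⟩), hp⟩) fun X => by
        have hX : X ∈ support e t c (z * u) := by
          rw [hzu, support_self]
          trivial
        rw [support_mul e hz hu hzut] at hX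
        rcases hX with hX | hX
        · exact ⟨z, by simp, hX⟩
        · obtain ⟨v, hv, hXv⟩ := (hcov X).1 hX
          exact ⟨v, List.mem_cons_of_mem _ hv, hXv⟩
    obtain ⟨y, hy⟩ := exists_listProd_eq hne
    rw [listProd_cons, hy, ← WithOne.coe_mul, WithOne.coe_inj, ← hzu] at key
    rw [hy, h.mul_left_cancel key (key ▸ hzut)]

theorem support_injective {u v : S} (hu : IsNil t u) (hv : IsNil t v)
    (huv : support e t c u = support e t c v) : u = v := by
  have := h.listProd_eq_of_partition_support e hv (l := [u]) (by simpa using hu) (by simp)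
    (by simp [huv])
  simpa using this

theorem mul_eq_of_support {u v w : S} (hu : IsNil t u) (hv : IsNil t v) (hw : IsNil t w)
    (hd : Disjoint (support e t c u) (support e t c v))
    (huv : support e t c u ∪ support e t c v = support e t c w) : u * v = w := by
  have := h.listProd_eq_of_partition_support e hw (l := [u, v]) (by simpa using ⟨hu, hv⟩)
    (by simpa using hd) (by simp [← huv])
  simpa [← WithOne.coe_mul] using this

omit [Finite S] in
/-- A product of nil elements other than the top is nil, and its support is the disjoint union of
the supports of the factors. -/
theorem partition_of_listProd {l : List S} (hl : ∀ v ∈ l, IsNil t v) {x : S} (hx : x ≠ t)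
    (hlx : listProd l = x) : IsNil t x ∧
      l.Pairwise (fun u v => Disjoint (support e t c u) (support e t c v)) ∧
      ∀ X : Point e t c, X ∈ support e t c x ↔ ∃ v ∈ l, X ∈ support e t c v := by
  induction l generalizing x with
  | nil => exact absurd hlx WithOne.one_ne_coe
  | cons u l ih =>
    have hu := hl u (by simp)
    have hl' : ∀ v ∈ l, IsNil t v := fun v hv => hl v (List.mem_cons_of_mem _ hv)
    rcases eq_or_ne l [] with rfl | hne
    · have : u = x := by simpa using hlx
      subst this
      simpa using hu
    · obtain ⟨y, hy⟩ := exists_listProd_eq hne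
      rw [listProd_cons, hy, ← WithOne.coe_mul, WithOne.coe_inj] at hlx
      subst hlx
      obtain ⟨hyn, hp, hcov⟩ := ih hl' (h.right_ne_top hx) hy
      have hd := disjoint_support (c := c) e hu hyn hx
      refine ⟨h.isNil_mul hu hx, List.pairwise_cons.2 ⟨fun v hv => ?_, hp⟩, fun X => ?_⟩
      · exact hd.mono_right fun X hX => (hcov X).2 ⟨v, hv, hX⟩
      · rw [support_mul e hu hyn hx, Set.mem_union, hcov]
        simp

end NilOver

/-- Nil elements that are not products of two nil elements. -/
def IsAtomic {S : Type*} [Mul S] (t x : S) : Prop :=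
  IsNil t x ∧ ∀ y z, IsNil t y → IsNil t z → y * z ≠ x

/-! ### Atomic factorizations and the partition system -/

namespace NilOver

variable {S : Type u} [AiSemiring S] [Finite S] {t c : S} (h : NilOver t c) {n : ℕ} (e : S ≃ Fin n)
include h

/-- Induction on the size of the support: both factors of a non-atomic element have nonempty,
disjoint supports, so each is strictly smaller. -/
theorem exists_factorization {u : S} (hu : IsNil t u) :
    ∃ l : List S, (∀ v ∈ l, IsAtomic t v) ∧ listProd l = u := by
  obtain ⟨n, ⟨e⟩⟩ := Finite.exists_equiv_fin S
  induction hk : (support e t c u).ncard using Nat.strong_induction_on generalizing u with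
  | _ k ih =>
    by_cases ha : IsAtomic t u
    · exact ⟨[u], by simpa using ha, by simp⟩
    · simp only [IsAtomic, not_and, not_forall, not_not] at ha
      obtain ⟨y, z, hy, hz, rfl⟩ := ha hu
      have hd := disjoint_support (c := c) e hy hz hu.1
      have hcard := Set.ncard_union_eq hd (Set.toFinite _) (Set.toFinite _)
      rw [← support_mul e hy hz hu.1] at hcard
      have h1 := (Set.ncard_pos (Set.toFinite _)).2 (h.support_nonempty e hy)
      have h2 := (Set.ncard_pos (Set.toFinite _)).2 (h.support_nonempty e hz)
      obtain ⟨l, hl, hly⟩ := ih _ (by omega) hy rfl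
      obtain ⟨l', hl', hlz⟩ := ih _ (by omega) hz rfl
      refine ⟨l ++ l', ?_, by simp [hly, hlz]⟩
      intro v hv
      exact (List.mem_append.1 hv).elim (hl v) (hl' v)

theorem exists_complement {u : S} (hu : IsNil t u) {l : List S} (hlu : listProd l = u) :
    ∃ l' : List S, (∀ v ∈ l', IsAtomic t v) ∧ listProd (l ++ l') = c := by
  rcases h.exists_cofactor hu with rfl | ⟨z, hz, hzu⟩
  · exact ⟨[], by simp, by simpa using hlu⟩
  · obtain ⟨l', hl', hlz⟩ := h.exists_factorization hz
    exact ⟨l', hl', by rw [listProd_append, hlu, hlz, ← WithOne.coe_mul, h.mul_comm, hzu]⟩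

/-- The supports of the atomic elements. -/
def atomSupports (_ : NilOver t c) (e : S ≃ Fin n) : Set (Set (Point e t c)) :=
  {B | ∃ u, IsAtomic t u ∧ support e t c u = B}

omit [Finite S] in
theorem mem_edgeSet_of_listProd {l : List S} (hl : ∀ v ∈ l, IsAtomic t v) (hlc : listProd l = c) :
    {B | ∃ v ∈ l, support e t c v = B} ∈ (partitionHypergraph (h.atomSupports e)).edgeSet := by
  obtain ⟨-, hp, hcov⟩ := h.partition_of_listProd e (fun v hv => (hl v hv).1) h.ne_top hlc
  refine ⟨?_, ?_, ?_⟩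
  · rintro _ ⟨v, hv, rfl⟩
    exact ⟨v, hl v hv, rfl⟩
  · rintro _ ⟨u, hu, rfl⟩ _ ⟨v, hv, rfl⟩ huv
    have : Std.Symm fun u v => Disjoint (support e t c u) (support e t c v) :=
      ⟨fun _ _ huv => huv.symm⟩
    exact hp.forall hu hv fun he => huv (by rw [he])
  · refine Set.eq_univ_of_forall fun X => ?_
    obtain ⟨v, hv, hX⟩ := (hcov X).1 (support_self e ▸ Set.mem_univ X)
    exact ⟨_, ⟨v, hv, rfl⟩, hX⟩

-- Passes from hyperedges back to words: choosing one atomic element for each member of `D` gives a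
-- list to which the product lemmas apply.
omit [Finite S] in
theorem exists_list_of_pairwiseDisjoint {D : Set (Set (Point e t c))}
    (hD : D ⊆ h.atomSupports e) (hd : D.PairwiseDisjoint id) :
    ∃ l : List S, (∀ v ∈ l, IsAtomic t v ∧ support e t c v ∈ D) ∧
      (∀ B ∈ D, ∃ v ∈ l, support e t c v = B) ∧
      l.Pairwise fun u v => Disjoint (support e t c u) (support e t c v) := by
  have hfin : D.Finite := Set.toFinite D
  have : Nonempty S := ⟨c⟩
  have hD' : ∀ B ∈ D, ∃ u, IsAtomic t u ∧ support e t c u = B := fun _ hB => hD hB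
  choose! g hg using hD'
  have hmem : ∀ {B}, B ∈ hfin.toFinset.toList ↔ B ∈ D := by simp
  refine ⟨hfin.toFinset.toList.map g, ?_, ?_, ?_⟩
  · intro v hv
    obtain ⟨B, hB, rfl⟩ := List.mem_map.1 hv
    obtain ⟨h1, h2⟩ := hg B (hmem.1 hB)
    exact ⟨h1, h2.symm ▸ hmem.1 hB⟩
  · exact fun B hB => ⟨g B, List.mem_map_of_mem (hmem.2 hB), (hg B hB).2⟩
  · rw [List.pairwise_map]
    refine List.Nodup.pairwise_of_forall_ne (Finset.nodup_toList _) fun A hA B hB hAB => ?_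
    rw [hmem] at hA hB
    rw [(hg A hA).2, (hg B hB).2]
    exact hd hA hB hAB

/-- The partition system that represents `S`. -/
def partitionSystem : PartitionSystem (Point e t c) where
  family := h.atomSupports e
  nonempty := by
    rintro _ ⟨u, hu, rfl⟩
    exact h.support_nonempty e hu.1
  mem_edge := by
    rintro _ ⟨u, hu, rfl⟩
    obtain ⟨l, hl, hlc⟩ := h.exists_complement hu.1 (l := [u]) (by simp)
    exact ⟨_, h.mem_edgeSet_of_listProd e (by simpa using ⟨hu, hl⟩) hlc, u, by simp, rfl⟩
  indecomposable := by
    rintro _ ⟨u, hu, rfl⟩ ⟨G, hG, hlt, hd, hGu⟩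
    obtain ⟨l, hl, hlG, hp⟩ := h.exists_list_of_pairwiseDisjoint e hG hd
    have hlu := h.listProd_eq_of_partition_support e hu.1 (fun v hv => (hl v hv).1.1) hp
      fun X => by
        rw [← hGu, Set.mem_sUnion]
        constructor
        · rintro ⟨B, hB, hX⟩
          obtain ⟨v, hv, rfl⟩ := hlG B hB
          exact ⟨v, hv, hX⟩
        · rintro ⟨v, hv, hX⟩
          exact ⟨_, (hl v hv).2, hX⟩
    -- The list has product `u`. It is not empty; a single factor would have the support of `u`,
    -- which is not a proper subset; and two or more factors contradict atomicity.
    obtain _ | ⟨v, l⟩ := l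
    · exact WithOne.one_ne_coe hlu
    have hv := hl v (by simp)
    rcases eq_or_ne l [] with rfl | hne
    · have : v = u := by simpa using hlu
      subst this
      exact (hlt _ hv.2).ne rfl
    · obtain ⟨y, hy⟩ := exists_listProd_eq hne
      rw [listProd_cons, hy, ← WithOne.coe_mul, WithOne.coe_inj] at hlu
      refine hu.2 v y hv.1.1 ?_ hlu
      exact (h.partition_of_listProd e (fun w hw => (hl w (List.mem_cons_of_mem _ hw)).1.1)
        (h.right_ne_top (hlu ▸ hu.1.1)) hy).1

/-- Part of a hyperedge is a part of an atomic factorization of `c`, and its product is the required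
nil element. Conversely, an atomic factorization of `u` extends by one of a cofactor to a hyperedge.
-/
theorem mem_unions_iff {U : Set (Point e t c)} :
    U ∈ (h.partitionSystem e).unions ↔ ∃ u, IsNil t u ∧ support e t c u = U := by
  constructor
  · rintro ⟨E, hE, D, hDE, hne, rfl⟩
    obtain ⟨l, hl, hlD, hp⟩ := h.exists_list_of_pairwiseDisjoint e (hDE.trans hE.1)
      (hE.2.1.subset hDE)
    obtain ⟨l', hl', hlD', hp'⟩ := h.exists_list_of_pairwiseDisjoint e
      (Set.sdiff_subset.trans hE.1 : E \ D ⊆ _) (hE.2.1.subset Set.sdiff_subset)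
    obtain ⟨B, hB⟩ := hne
    have hlne : l ≠ [] := by
      rintro rfl
      obtain ⟨v, hv, -⟩ := hlD B hB
      cases hv
    have hc := h.listProd_eq_of_partition e (l := l ++ l') (by simp [hlne])
      (fun v hv => (List.mem_append.1 hv).elim (fun hv => (hl v hv).1.1) fun hv =>
        (hl' v hv).1.1)
      (List.pairwise_append.2 ⟨hp, hp', fun u hu v hv => hE.2.1 (hDE (hl u hu).2) (hl' v hv).2.1
        fun huv => (hl' v hv).2.2 (huv.subst (motive := (· ∈ D)) (hl u hu).2)⟩)
      fun X => by
        obtain ⟨B, hB, hX⟩ : X ∈ ⋃₀ E := hE.2.2 ▸ Set.mem_univ X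
        by_cases hBD : B ∈ D
        · obtain ⟨v, hv, rfl⟩ := hlD B hBD
          exact ⟨v, List.mem_append_left _ hv, hX⟩
        · obtain ⟨v, hv, rfl⟩ := hlD' B ⟨hB, hBD⟩
          exact ⟨v, List.mem_append_right _ hv, hX⟩
    obtain ⟨y, hy⟩ := exists_listProd_eq hlne
    -- `y` is an initial part of a product equal to `c`, and `t` is absorbing.
    have hyt : y ≠ t := by
      rintro rfl
      rw [listProd_append, hy] at hc
      rcases eq_or_ne l' [] with rfl | hne'
      · rw [listProd_nil, _root_.mul_one, WithOne.coe_inj] at hc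
        exact h.ne_top hc.symm
      · obtain ⟨z, hz⟩ := exists_listProd_eq hne'
        rw [hz, ← WithOne.coe_mul, WithOne.coe_inj, h.top_mul] at hc
        exact h.ne_top hc.symm
    obtain ⟨hyn, -, hcov⟩ := h.partition_of_listProd e (fun v hv => (hl v hv).1.1) hyt hy
    refine ⟨y, hyn, Set.ext fun X => (hcov X).trans ?_⟩
    rw [Set.mem_sUnion]
    constructor
    · rintro ⟨v, hv, hX⟩
      exact ⟨_, (hl v hv).2, hX⟩
    · rintro ⟨B, hB, hX⟩
      obtain ⟨v, hv, rfl⟩ := hlD B hB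
      exact ⟨v, hv, hX⟩
  · rintro ⟨u, hu, rfl⟩
    obtain ⟨l, hl, hlu⟩ := h.exists_factorization hu
    obtain ⟨l', hl', hlc⟩ := h.exists_complement hu hlu
    obtain ⟨-, -, hcov⟩ := h.partition_of_listProd e (fun v hv => (hl v hv).1) hu.1 hlu
    refine ⟨_, h.mem_edgeSet_of_listProd e (l := l ++ l') (fun v hv =>
      (List.mem_append.1 hv).elim (hl v) (hl' v)) hlc, {B | ∃ v ∈ l, support e t c v = B}, ?_, ?_,
      Set.ext fun X => (hcov X).trans ?_⟩
    · rintro _ ⟨v, hv, rfl⟩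
      exact ⟨v, List.mem_append_left _ hv, rfl⟩
    · obtain ⟨X, hX⟩ := h.support_nonempty e hu
      obtain ⟨v, hv, -⟩ := (hcov X).1 hX
      exact ⟨_, v, hv, rfl⟩
    · simp

/-- The nil elements correspond to the blocks. -/
noncomputable def blockEquiv : {x : S // IsNil t x} ≃ (h.partitionSystem e).Block :=
  Equiv.ofBijective (fun x => ⟨support e t c x, (h.mem_unions_iff e).2 ⟨x, x.2, rfl⟩⟩) <| by
    constructor
    · intro x y hxy
      exact Subtype.ext (h.support_injective e x.2 y.2 (congrArg Subtype.val hxy))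
    · rintro ⟨U, hU⟩
      obtain ⟨u, hu, rfl⟩ := (h.mem_unions_iff e).1 hU
      exact ⟨⟨u, hu⟩, rfl⟩

theorem blockMul_blockEquiv (x y z : {x : S // IsNil t x}) :
    PartitionSystem.blockMul (h.blockEquiv e x) (h.blockEquiv e y) = some (h.blockEquiv e z) ↔
      x.1 * y.1 = z.1 := by
  rw [PartitionSystem.blockMul_eq_some]
  change Disjoint (support e t c x) (support e t c y) ∧
    support e t c x ∪ support e t c y = support e t c z ↔ _
  constructor
  · rintro ⟨h1, h2⟩
    exact h.mul_eq_of_support e x.2 y.2 z.2 h1 h2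
  · intro hxy
    have hne : x.1 * y.1 ≠ t := hxy ▸ z.2.1
    rw [← hxy, support_mul e x.2 y.2 hne]
    exact ⟨disjoint_support e x.2 y.2 hne, rfl⟩

end NilOver

end AiSem

namespace AiSem

open PartialSemigroup

/-! ### Recognizing flat semirings -/

theorem IsHom.nonempty_ringEquiv {A B : Type*} [AiSemiring A] [AiSemiring B] {f : A → B}
    (hf : IsHom f) (hb : Function.Bijective f) : Nonempty (B ≃+* A) :=
  ⟨RingEquiv.symm { Equiv.ofBijective f hb with map_add' := hf.1, map_mul' := hf.2 }⟩

/-- A semiring that is flat over `t` is isomorphic to the flat extension of any partial semigroup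
that is isomorphic to the partial semigroup of its elements other than `t`. -/
theorem nonempty_ringEquiv_flat {S : Type u} [AiSemiring S] {t : S} (htm : ∀ x, t * x = t)
    (hmt : ∀ x, x * t = t) (hadd : ∀ x y : S, x ≠ y → x + y = t) {Q : Type v} [PartialSemigroup Q]
    (g : Q → S) (hg : Function.Injective g) (hrange : ∀ x, x ≠ t ↔ ∃ q, g q = x)
    (hmul : ∀ p q r, pmul p q = some r ↔ g p * g q = g r) : Nonempty (S ≃+* Flat Q) := by
  classical
  let f : Flat Q → S := fun x => match x with
    | Flat.inf => t
    | Flat.elem q => g q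
  have hgt : ∀ q, g q ≠ t := fun q => (hrange _).2 ⟨q, rfl⟩
  have hf : Function.Bijective f := by
    constructor
    · rintro (_ | p) (_ | q) hpq
      · rfl
      · exact absurd hpq.symm (hgt q)
      · exact absurd hpq (hgt p)
      · exact congrArg Flat.elem (hg hpq)
    · intro x
      by_cases hx : x = t
      · exact ⟨Flat.inf, hx.symm⟩
      · obtain ⟨q, hq⟩ := (hrange x).1 hx
        exact ⟨Flat.elem q, hq⟩
  refine IsHom.nonempty_ringEquiv (f := f) ⟨fun x y => ?_, fun x y => ?_⟩ hf
  · change f (x + y) = f x + f y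
    rw [Flat.add_def]
    split_ifs with hxy
    · rw [hxy, AiSemiring.add_self]
    · exact (hadd _ _ (hf.1.ne hxy)).symm
  · change f (x * y) = f x * f y
    rcases x with _ | p
    · rw [Flat.inf_mul]
      exact (htm _).symm
    rcases y with _ | q
    · rw [Flat.mul_inf]
      exact (hmt _).symm
    rw [Flat.elem_mul]
    rcases hpq : pmul p q with _ | r
    · change t = g p * g q
      by_contra hne
      obtain ⟨r, hr⟩ := (hrange _).1 (Ne.symm hne)
      rw [(hmul p q r).2 hr.symm] at hpq
      cases hpq
    · exact ((hmul p q r).1 hpq).symm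

/-- The empty family is a partition system without blocks, so its semiring is `{∞}`. -/
theorem isBlockHypergraphSemiring_of_subsingleton (S : Type u) [AiSemiring S] [Nonempty S]
    [Subsingleton S] : IsBlockHypergraphSemiring S := by
  let F : PartitionSystem Unit :=
    ⟨∅, fun _ h => h.elim, fun _ h => h.elim, fun _ h => h.elim⟩
  have hF : ∀ U, U ∉ F.unions := by
    rintro U ⟨E, hE, D, hD, ⟨B, hB⟩, -⟩
    exact hE.1 (hD hB)
  obtain ⟨t⟩ := ‹Nonempty S›
  exact ⟨Unit, inferInstance, F, nonempty_ringEquiv_flat (t := t) (fun _ => Subsingleton.elim _ _)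
    (fun _ => Subsingleton.elim _ _) (fun _ _ _ => Subsingleton.elim _ _)
    (fun q => (hF q.1 q.2).elim) (fun q => (hF q.1 q.2).elim)
    (fun x => ⟨fun hx => (hx (Subsingleton.elim _ _)).elim, fun ⟨q, _⟩ => (hF q.1 q.2).elim⟩)
    (fun q => (hF q.1 q.2).elim)⟩

/-- The only idempotent of `S_ℍ` is the top element. -/
theorem IsBlockHypergraphSemiring.idem_unique {S : Type u} [AiSemiring S]
    (h : IsBlockHypergraphSemiring S) {x y : S} (hx : x * x = x) (hy : y * y = y) : x = y := by
  obtain ⟨I, _, F, ⟨φ⟩⟩ := h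
  have key : ∀ x : S, x * x = x → φ x = Flat.inf := by
    intro x hx
    have := congrArg φ hx
    rw [map_mul] at this
    rcases hφ : φ x with _ | B
    · rfl
    · rw [hφ, Flat.elem_mul] at this
      rcases hB : pmul B B with _ | C
      · rw [hB] at this
        cases this
      · rw [hB] at this
        cases this
        exact absurd hB (PartitionSystem.blockMul_ne _ _)
  exact φ.injective ((key x hx).trans (key y hy).symm)

/-! ### The cases `M₂`, `S₇`, `S_ℍ` and `S¹_ℍ` -/

namespace FlatOver

variable {S : Type u} [AiSemiring S] {t c : S} (h : FlatOver t c)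
include h

theorem nonempty_ringEquiv_m2 (hS : SatisfiesWordInequalities S) (hc : c * c = c) :
    Nonempty (S ≃+* M2) := by
  let f : M2 → S := fun x => match x with
    | M2.inf => t
    | M2.one => c
  have hf : Function.Bijective f := by
    constructor
    · rintro (_ | _) (_ | _) hxy
      · rfl
      · exact absurd hxy.symm h.ne_top
      · exact absurd hxy h.ne_top
      · rfl
    · intro x
      by_cases hx : x = t
      · exact ⟨M2.inf, hx.symm⟩
      · exact ⟨M2.one, (h.eq_of_idem hS hc hx).symm⟩
  refine IsHom.nonempty_ringEquiv (f := f) ⟨?_, ?_⟩ hf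
  · rintro (_ | _) (_ | _)
    · exact (AiSemiring.add_self t).symm
    · exact (h.add_of_ne t c h.ne_top.symm).symm
    · exact (h.add_top c).symm
    · exact (AiSemiring.add_self c).symm
  · rintro (_ | _) (_ | _)
    · exact (h.mul_top t).symm
    · exact (h.top_mul c).symm
    · exact (h.mul_top c).symm
    · exact hc.symm

end FlatOver

namespace NilOver

variable {S : Type u} [AiSemiring S] {t c : S} (h : NilOver t c)
include h

theorem containsCopy {i : S} (hi : i * i = i) (hit : i ≠ t) : ContainsCopy S7.{u} S := by
  have hic : i * c = c := h.idem_mul h.words hi hit c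
  have hne : i ≠ c := by
    rintro rfl
    exact hit (hi.symm.trans h.sq_top)
  refine ⟨fun x => match x with
    | S7.inf => t
    | S7.a => c
    | S7.one => i, ⟨?_, ?_⟩, ?_⟩
  · rintro (_ | _ | _) (_ | _ | _)
    · exact (AiSemiring.add_self t).symm
    · exact (h.add_of_ne _ _ h.ne_top.symm).symm
    · exact (h.add_of_ne _ _ hit.symm).symm
    · exact (h.add_top _).symm
    · exact (AiSemiring.add_self c).symm
    · exact (h.add_of_ne _ _ hne.symm).symm
    · exact (h.add_top _).symm
    · exact (h.add_of_ne _ _ hne).symm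
    · exact (AiSemiring.add_self i).symm
  · rintro (_ | _ | _) (_ | _ | _)
    · exact (h.mul_top t).symm
    · exact (h.top_mul _).symm
    · exact (h.top_mul _).symm
    · exact (h.mul_top _).symm
    · exact h.sq_top.symm
    · exact ((h.mul_comm c i).trans hic).symm
    · exact (h.mul_top _).symm
    · exact hic.symm
    · exact hi.symm
  · rintro (_ | _ | _) (_ | _ | _) hxy
    · rfl
    · exact absurd hxy.symm h.ne_top
    · exact absurd hxy.symm hit
    · exact absurd hxy h.ne_top
    · rfl
    · exact absurd hxy.symm hne
    · exact absurd hxy hit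
    · exact absurd hxy hne
    · rfl

variable [Finite S]

theorem isBlockHypergraphSemiring (hno : ∀ x, x ≠ t → IsNil t x) :
    IsBlockHypergraphSemiring S := by
  obtain ⟨n, ⟨e⟩⟩ := Finite.exists_equiv_fin S
  refine ⟨Point e t c, inferInstance, h.partitionSystem e, nonempty_ringEquiv_flat h.top_mul
    h.mul_top h.add_of_ne (fun B => ((h.blockEquiv e).symm B : S))
    (Subtype.val_injective.comp (h.blockEquiv e).symm.injective) (fun x => ⟨fun hx =>
      ⟨h.blockEquiv e ⟨x, hno x hx⟩, by simp⟩, ?_⟩) fun A B C => ?_⟩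
  · rintro ⟨B, rfl⟩
    exact ((h.blockEquiv e).symm B).2.1
  · rw [← h.blockMul_blockEquiv e]
    simp only [Equiv.apply_symm_apply]
    rfl

/-- The elements other than `t` are the nil ones, which correspond to blocks, and the unique
idempotent `i`, which plays the role of the adjoined identity. -/
theorem isBlockHypergraphSemiringOne {i : S} (hi : i * i = i) (hit : i ≠ t) :
    IsBlockHypergraphSemiringOne S := by
  obtain ⟨n, ⟨e⟩⟩ := Finite.exists_equiv_fin S
  have hil : ∀ y, i * y = y := h.idem_mul h.words hi hit
  have hir : ∀ y, y * i = y := fun y => (h.mul_comm y i).trans (hil y)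
  have hin : ¬ IsNil t i := fun hn => hit (hi.symm.trans hn.2)
  let b : (h.partitionSystem e).Block → S := fun B => (h.blockEquiv e).symm B
  have hbi : ∀ B, b B ≠ i := fun B hB => hin (hB ▸ ((h.blockEquiv e).symm B).2)
  have hb : Function.Injective b :=
    Subtype.val_injective.comp (h.blockEquiv e).symm.injective
  have hbmul : ∀ A B C, PartitionSystem.blockMul A B = some C ↔ b A * b B = b C := by
    intro A B C
    rw [← h.blockMul_blockEquiv e]
    simp only [Equiv.apply_symm_apply]
  let g : Option (h.partitionSystem e).Block → S := fun o => o.elim i b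
  have hg : Function.Injective g := by
    rintro (_ | A) (_ | B) hAB
    · rfl
    · exact absurd hAB.symm (hbi B)
    · exact absurd hAB (hbi A)
    · exact congrArg some (hb hAB)
  refine ⟨Point e t c, inferInstance, h.partitionSystem e, nonempty_ringEquiv_flat h.top_mul
    h.mul_top h.add_of_ne g hg (fun x => ⟨fun hx => ?_, ?_⟩) ?_⟩
  · rcases h.isNil_or_idem hx with hn | hxx
    · exact ⟨some (h.blockEquiv e ⟨x, hn⟩), by simp [g, b]⟩
    · exact ⟨none, h.idem_unique h.words hi hit hxx hx⟩
  · rintro ⟨_ | B, rfl⟩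
    · exact hit
    · exact ((h.blockEquiv e).symm B).2.1
  · rintro (_ | A) q r
    · change some q = some r ↔ i * g q = g r
      rw [hil, hg.eq_iff, Option.some_inj]
    rcases q with _ | B
    · change some (some A) = some r ↔ b A * i = g r
      rw [hir, Option.some_inj]
      exact (hg.eq_iff (a := some A)).symm
    change (PartitionSystem.blockMul A B).map some = some r ↔ b A * b B = g r
    rcases r with _ | C
    -- A product of nil elements is nil or `t`, hence never the identity.
    · refine iff_of_false (by simp) fun (hAB : b A * b B = i) => ?_
      have hA : IsNil t (b A) := ((h.blockEquiv e).symm A).2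
      exact hin (hAB ▸ h.isNil_mul hA (hAB ▸ hit))
    · rw [Option.map_eq_some_iff]
      simp only [Option.some_inj, exists_eq_right]
      exact hbmul A B C

end NilOver

end AiSem

/-! ### The classification -/

theorem mainTheorem5 (S : Type u) [AiSem.AiSemiring S] [Nonempty S] [Finite S]
    (hS : AiSem.InVariety AiSem.S7.{u} S) (hsi : AiSem.SubdirectlyIrreducible S) :
    -- at least one of the three alternatives holds
    (Nonempty (S ≃+* AiSem.M2) ∨ AiSem.ContainsCopy AiSem.S7.{u} S ∨
      AiSem.IsBlockHypergraphSemiring S) ∧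
    -- and no two of them hold together
    ¬ (Nonempty (S ≃+* AiSem.M2) ∧ AiSem.ContainsCopy AiSem.S7.{u} S) ∧
    ¬ (Nonempty (S ≃+* AiSem.M2) ∧ AiSem.IsBlockHypergraphSemiring S) ∧
    ¬ (AiSem.ContainsCopy AiSem.S7.{u} S ∧ AiSem.IsBlockHypergraphSemiring S) ∧
    -- in the second case `V(S) = V(S₇)`, and `S` is some `S¹_ℍ`
    (AiSem.ContainsCopy AiSem.S7.{u} S →
      (∀ (A : Type u) [AiSem.AiSemiring A],
        AiSem.InVariety S A ↔ AiSem.InVariety AiSem.S7.{u} A) ∧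
      AiSem.IsBlockHypergraphSemiringOne S) := by
  open AiSem in
  have hW := hS.satisfiesWordInequalities
  have hM2 : Nonempty (S ≃+* M2) → ¬ ContainsCopy S7.{u} S := by
    rintro ⟨φ⟩ ⟨f, -, hf⟩
    have hinj := φ.injective.comp hf
    have h1 := hinj.ne (a₁ := S7.inf) (a₂ := S7.a) S7.noConfusion
    have h2 := hinj.ne (a₁ := S7.inf) (a₂ := S7.one) S7.noConfusion
    have h3 := hinj.ne (a₁ := S7.a) (a₂ := S7.one) S7.noConfusion
    revert h1 h2 h3
    generalize (φ ∘ f) S7.inf = p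
    generalize (φ ∘ f) S7.a = q
    generalize (φ ∘ f) S7.one = r
    cases p <;> cases q <;> cases r <;> simp
  refine ⟨?_, fun h => hM2 h.1 h.2, ?_, ?_, fun hcopy => ⟨fun A _ => ⟨?_, ?_⟩, ?_⟩⟩
  · rcases subsingleton_or_nontrivial S with _ | _
    · exact Or.inr (Or.inr (isBlockHypergraphSemiring_of_subsingleton S))
    obtain ⟨t, c, h⟩ := hsi.exists_flatOver hW
    rcases h.sq_eq hW c with hc | hc
    · exact Or.inl (h.nonempty_ringEquiv_m2 hW hc)
    have hN : NilOver t c := ⟨h, hW, hc⟩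
    by_cases hno : ∀ x, x ≠ t → IsNil t x
    · exact Or.inr (Or.inr (hN.isBlockHypergraphSemiring hno))
    · push Not at hno
      obtain ⟨i, hit, hi⟩ := hno
      exact Or.inr (Or.inl (hN.containsCopy ((hN.isNil_or_idem hit).resolve_left hi) hit))
  · rintro ⟨⟨φ⟩, hB⟩
    have := hB.idem_unique (x := φ.symm M2.inf) (y := φ.symm M2.one)
      (by rw [← map_mul]; rfl) (by rw [← map_mul]; rfl)
    cases φ.symm.injective this
  · rintro ⟨⟨f, hf, hinj⟩, hB⟩
    have := hB.idem_unique (x := f S7.inf) (y := f S7.one)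
      (by rw [← hf.2]; rfl) (by rw [← hf.2]; rfl)
    cases hinj this
  · exact fun hA K hK hK7 => hA K hK (hS K hK hK7)
  · intro hA K hK hKS
    obtain ⟨f, hf, hinj⟩ := hcopy
    have : Nonempty S7.{u} := ⟨S7.a⟩
    exact hA K hK (hK.sub S S7.{u} f hf hinj hKS)
  · obtain ⟨f, hf, hinj⟩ := id hcopy
    have : Nontrivial S := ⟨f S7.inf, f S7.one, fun he => by cases hinj he⟩
    obtain ⟨t, c, h⟩ := hsi.exists_flatOver hW
    rcases h.sq_eq hW c with hc | hc
    · exact absurd hcopy (hM2 (h.nonempty_ringEquiv_m2 hW hc))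
    have hN : NilOver t c := ⟨h, hW, hc⟩
    -- The images of `1` and `∞` are distinct idempotents, so at least one of them differs from `t`;
    -- either serves as the identity.
    by_cases hit : f S7.one = t
    · refine hN.isBlockHypergraphSemiringOne (i := f S7.inf) (by rw [← hf.2]; rfl) fun he => ?_
      cases hinj (he.trans hit.symm)
    · exact hN.isBlockHypergraphSemiringOne (by rw [← hf.2]; rfl) hit
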